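/- Let $d\ge 2$. Let $c\colon S^{d-1}\to S^{d-1}\vee S^{d-1}$ be the $(d-2)$-fold suspension of the map $S^1\to S^1\vee S^1$ given by the loop $xy^{-1}$, where $x,y$ are the two inclusions $S^1\to S^1\vee S^1$. Let $X=(S^{d-1}\vee S^{d-1})\cup(D^d\amalg D^d)$ be the CW complex obtained by attaching two $d$-cells $e_1,e_2$ to $S^{d-1}\vee S^{d-1}$, each along $c$; let $f_1,f_2$ be its $(d-1)$-cells, and let $\partial\colon C_d(X)\to C_{d-1}(X)$ be the cellular boundary operator, whose entries are the degrees of the attaching maps followed by the projections onto the two spheres. Let $E_1,W_1\colon[0,1]\to\mathbb R$ be smooth functions such that $W_1(0)=W_1(1/2)=W_1(1)=0$, $W_1<0$ on $(0,1/2)$, $W_1>0$ on $(1/2,1)$, $E_1(0)=E_1(1)=-1$ and $E_1(1/2)>0$. Put $E_2=-E_1$, $W_2=-W_1$, and extend all four functions $1$-periodically to $\mathbb R$. For $\beta>0$ set $\partial^*_{E,W}=e^{-\beta W}\partial^*e^{\beta E}\colon C_{d-1}(X;\mathbb R)\to C_d(X;\mathbb R)$, where $\partial^*$ is the adjoint of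 $\partial$ for the standard inner products and $e^{\beta E}$, $e^{-\beta W}$ are the diagonal operators $f_i\mapsto e^{\beta E_i}f_i$, $e_i\mapsto e^{-\beta W_i}e_i$. Then $e_1-e_2$ is a cycle that generates $H_d(X;\mathbb Z)\cong\mathbb Z$, and the following holds. For every $\beta>0$ there is $\tau_0>0$ such that for every $\tau>\tau_0$ the equation $\dot\rho=-\tau\,\partial\,\partial^*_{E,W}\,\rho$ has a unique $1$-periodic solution $\rho=\rho_{\tau,\beta}\colon\mathbb R\to C_{d-1}(X;\mathbb R)$ with values in cycles homologous to $f_1$, and the average current $$Q_{\tau,\beta}=\int_0^1\tau\,\partial^*_{E,W}\,\rho_{\tau,\beta}(t)\,dt\in C_d(X;\mathbb R)$$ is a cycle, i.e. an element of $H_d(X;\mathbb R)$. For every $\beta>0$ the adiabatic limit $Q^B_\beta=\lim_{\tau\to\infty}Q_{\tau,\beta}$ exists, and in the low temperature limit $$\lim_{\beta\to\infty}Q^B_\beta=e_1-e_2 .$$ -/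

import Mathlib

open Set Filter Topology
open scoped unitInterval ContDiff Topology.Homotopy

noncomputable section

/-! ### Spheres and wedges of spheres

The `n`-sphere is modelled as the cube `I^n` with its boundary collapsed to the base point; the
wedge of `p` spheres is `p` copies of the cube with all boundaries collapsed to one point. -/

namespace CycleFluctuation

/-- Two points of `p` disjoint `n`-cubes are identified when both are boundary points. -/
def wedgeSetoid (p n : ℕ) : Setoid (Fin p × (Fin n → I)) where
  r a b := a = b ∨ (a.2 ∈ Cube.boundary (Fin n) ∧ b.2 ∈ Cube.boundary (Fin n))
  iseqv := by
    refine ⟨fun _ => Or.inl rfl, ?_, ?_⟩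
    · rintro a b (h | h)
      · exact Or.inl h.symm
      · exact Or.inr ⟨h.2, h.1⟩
    · rintro a b c (rfl | h) (rfl | k)
      · exact Or.inl rfl
      · exact Or.inr k
      · exact Or.inr h
      · exact Or.inr ⟨h.1, k.2⟩

/-- The wedge `S^n ∨ ⋯ ∨ S^n` of `p` spheres, with the quotient topology. -/
def Wedge (p n : ℕ) : Type := Quotient (wedgeSetoid p n)

instance (p n : ℕ) : TopologicalSpace (Wedge p n) :=
  inferInstanceAs (TopologicalSpace (Quotient (wedgeSetoid p n)))

/-- The sphere `S^n = I^n / ∂I^n`. -/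
abbrev Sphere (n : ℕ) : Type := Wedge 1 n

namespace Wedge

variable {p n : ℕ}

/-- The point of the wedge with cube coordinates `u` in the `i`-th sphere. -/
def mk (i : Fin p) (u : Fin n → I) : Wedge p n := Quotient.mk (wedgeSetoid p n) (i, u)

theorem isQuotientMap_mk : IsQuotientMap (fun a : Fin p × (Fin n → I) => mk a.1 a.2) :=
  isQuotientMap_quot_mk

theorem mk_eq_mk (i j : Fin p) {u v : Fin n → I} (hu : u ∈ Cube.boundary (Fin n))
    (hv : v ∈ Cube.boundary (Fin n)) : mk i u = mk j v :=
  Quotient.sound (s := wedgeSetoid p n) (Or.inr ⟨hu, hv⟩)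

theorem continuous_mk (i : Fin p) : Continuous (mk i : (Fin n → I) → Wedge p n) :=
  isQuotientMap_mk.continuous.comp (Continuous.prodMk_right i)

/-- The base point (for `n ≥ 1`): the common image of all the boundaries. -/
def base [NeZero p] : Wedge p n := mk 0 (fun _ => 0)

theorem mk_eq_base [NeZero p] (i : Fin p) {u : Fin (n + 1) → I}
    (hu : u ∈ Cube.boundary (Fin (n + 1))) : mk i u = base :=
  mk_eq_mk _ _ hu ⟨0, Or.inl rfl⟩

/-- The underlying function of `pinch`. -/
def pinchFun (j : Fin p) : Wedge p n → Sphere n :=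
  Quotient.lift (s := wedgeSetoid p n) (fun a => mk 0 (if a.1 = j then a.2 else fun _ => 0)) (by
    rintro ⟨i, u⟩ ⟨k, v⟩ (h | ⟨hu, hv⟩)
    · rw [h]
    · obtain ⟨i₀, hi⟩ := hu
      refine mk_eq_mk _ _ ?_ ?_
      · dsimp only
        split_ifs
        · exact ⟨i₀, hi⟩
        · exact ⟨i₀, Or.inl rfl⟩
      · dsimp only
        split_ifs
        · exact hv
        · exact ⟨i₀, Or.inl rfl⟩)

/-- The projection `S^n ∨ ⋯ ∨ S^n → S^n` onto the `j`-th summand, collapsing the others. -/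
def pinch (j : Fin p) : C(Wedge p n, Sphere n) where
  toFun := pinchFun j
  continuous_toFun := by
    rw [isQuotientMap_mk.continuous_iff, continuous_prod_of_discrete_left]
    intro i
    change Continuous fun u : Fin n → I => mk 0 (if i = j then u else fun _ => 0)
    refine (continuous_mk 0).comp ?_
    split_ifs
    · exact continuous_id
    · exact continuous_const

/-! ### Loops in a wedge of circles and their suspensions -/

/-- The loop running once around the `i`-th circle of a wedge of circles. -/
def circleLoop [NeZero p] (i : Fin p) : Path (base : Wedge p 1) base where
  toFun t := mk i (fun _ => t)
  continuous_toFun := (continuous_mk i).comp (continuous_pi fun _ => continuous_id)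
  source' := mk_eq_base i ⟨0, Or.inl rfl⟩
  target' := mk_eq_base i ⟨0, Or.inr rfl⟩

theorem cons_mem_boundary {t : I} {s : Fin n → I}
    (h : (t = 0 ∨ t = 1) ∨ s ∈ Cube.boundary (Fin n)) :
    (Fin.cons t s : Fin (n + 1) → I) ∈ Cube.boundary (Fin (n + 1)) := by
  obtain h | ⟨i, h⟩ := h
  · exact ⟨0, by simpa using h⟩
  · exact ⟨i.succ, by simpa using h⟩

/-- The map `(S^1 ∨ ⋯ ∨ S^1) × I^n → (S^1 ∨ ⋯ ∨ S^1) ∧ S^n = S^{n+1} ∨ ⋯ ∨ S^{n+1}`,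
`(w, s) ↦ w ∧ s`. -/
def smash (w : Wedge p 1) (s : Fin n → I) : Wedge p (n + 1) :=
  Quotient.lift (s := wedgeSetoid p 1) (fun a => mk a.1 (Fin.cons (a.2 0) s)) (by
    rintro ⟨i, u⟩ ⟨k, v⟩ (h | ⟨⟨i₀, hu⟩, ⟨k₀, hv⟩⟩)
    · rw [h]
    · obtain rfl : i₀ = 0 := Subsingleton.elim _ _
      obtain rfl : k₀ = 0 := Subsingleton.elim _ _
      exact mk_eq_mk _ _ (cons_mem_boundary (Or.inl hu)) (cons_mem_boundary (Or.inl hv))) w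

theorem continuous_smash :
    Continuous fun a : Wedge p 1 × (Fin n → I) => smash a.1 a.2 := by
  refine isQuotientMap_mk.continuous_lift_prod_left ?_
  change Continuous fun a : (Fin p × (Fin 1 → I)) × (Fin n → I) =>
    (mk a.1.1 (Fin.cons (a.1.2 0) a.2) : Wedge p (n + 1))
  refine isQuotientMap_mk.continuous.comp
    (f := fun a : (Fin p × (Fin 1 → I)) × (Fin n → I) =>
      (a.1.1, (Fin.cons (a.1.2 0) a.2 : Fin (n + 1) → I))) ?_
  refine Continuous.prodMk (by fun_prop) (continuous_pi fun i => ?_)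
  refine Fin.cases ?_ (fun j => ?_) i
  · simp only [Fin.cons_zero]; fun_prop
  · simp only [Fin.cons_succ]; fun_prop

theorem smash_base [NeZero p] (s : Fin n → I) : smash (base : Wedge p 1) s = base :=
  mk_eq_base (n := n) 0 (cons_mem_boundary (Or.inl (Or.inl rfl)))

theorem smash_boundary [NeZero p] (w : Wedge p 1) {s : Fin n → I}
    (hs : s ∈ Cube.boundary (Fin n)) : smash w s = base := by
  induction w using Quotient.inductionOn with
  | h a => exact mk_eq_base (n := n) a.1 (cons_mem_boundary (Or.inr hs))

/-- The underlying function of `suspend`. -/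
def suspendFun [NeZero p] (g : Path (base : Wedge p 1) base) (n : ℕ) :
    Sphere (n + 1) → Wedge p (n + 1) :=
  Quotient.lift (s := wedgeSetoid 1 (n + 1)) (fun a => smash (g (a.2 0)) (Fin.tail a.2)) (by
    have key : ∀ u ∈ Cube.boundary (Fin (n + 1)), smash (g (u 0)) (Fin.tail u) = base := by
      rintro u ⟨i, hi⟩
      induction i using Fin.cases with
      | zero =>
        obtain h | h := hi
        · rw [h, g.source, smash_base]
        · rw [h, g.target, smash_base]
      | succ j => exact smash_boundary _ ⟨j, hi⟩
    rintro ⟨i, u⟩ ⟨k, v⟩ (h | ⟨hu, hv⟩)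
    · rw [h]
    · exact (key u hu).trans (key v hv).symm)

/-- The `n`-fold (reduced) suspension `S^1 ∧ S^n → (S^1 ∨ ⋯ ∨ S^1) ∧ S^n`, `t ∧ s ↦ g t ∧ s`,
of the map `S^1 → S^1 ∨ ⋯ ∨ S^1` given by a loop `g`. -/
def suspend [NeZero p] (g : Path (base : Wedge p 1) base) (n : ℕ) :
    C(Sphere (n + 1), Wedge p (n + 1)) where
  toFun := suspendFun g n
  continuous_toFun := by
    rw [isQuotientMap_mk.continuous_iff]
    change Continuous fun a : Fin 1 × (Fin (n + 1) → I) => smash (g (a.2 0)) (Fin.tail a.2)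
    refine continuous_smash.comp
      (f := fun a : Fin 1 × (Fin (n + 1) → I) => (g (a.2 0), Fin.tail a.2)) ?_
    refine Continuous.prodMk (by fun_prop) (continuous_pi fun i => ?_)
    simp only [Fin.tail]
    fun_prop

end Wedge

/-! ### Degree -/

/-- A pointed self-map of `S^{n+1}`, as a generalized loop `I^{n+1} → S^{n+1}`. -/
def sphereLoop {n : ℕ} (f : C(Sphere (n + 1), Sphere (n + 1))) (hf : f Wedge.base = Wedge.base) :
    GenLoop (Fin (n + 1)) (Sphere (n + 1)) Wedge.base :=
  ⟨f.comp ⟨Wedge.mk 0, Wedge.continuous_mk 0⟩, fun u hu => by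
    change f (Wedge.mk 0 u) = Wedge.base
    rw [Wedge.mk_eq_base 0 hu, hf]⟩

/-- The class of a pointed self-map of `S^{n+1}` in `π_{n+1}(S^{n+1})`. -/
def homotopyClass {n : ℕ} (f : C(Sphere (n + 1), Sphere (n + 1))) (hf : f Wedge.base = Wedge.base) :
    HomotopyGroup (Fin (n + 1)) (Sphere (n + 1)) Wedge.base :=
  Quotient.mk _ (sphereLoop f hf)

/-- `f : S^{n+1} → S^{n+1}` is a pointed map of degree `D`: its class in `π_{n+1}(S^{n+1}) ≅ ℤ` is
the `D`-th power of the class of the identity. -/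
def HasDegree {n : ℕ} (f : C(Sphere (n + 1), Sphere (n + 1))) (D : ℤ) : Prop :=
  ∃ hf : f Wedge.base = Wedge.base, homotopyClass f hf = homotopyClass (ContinuousMap.id _) rfl ^ D

/-! ### CW complexes obtained from a wedge of spheres by attaching top cells -/

/-- A CW complex of dimension `d = m + 2` with one `0`-cell, `p` cells of dimension `d - 1`, each
attached to the `0`-cell (so that the `(d - 1)`-skeleton is a wedge of `p` spheres `S^{d-1}`), and
`q` cells of dimension `d`, given by their attaching maps. -/
structure CellComplex (m p q : ℕ) where
  /-- The attaching maps of the `d`-cells. -/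
  attach : Fin q → C(Sphere (m + 1), Wedge p (m + 1))

namespace CellComplex

variable {m p q : ℕ}

/-- The gluing relation: the disk `D^d` is the cone on `S^{d-1}`, with cone point at parameter `0`
and boundary at parameter `1`; the boundary is glued along the attaching map. -/
inductive Glue (K : CellComplex m p q) :
    Wedge p (m + 1) ⊕ (Fin q × Sphere (m + 1) × I) →
      Wedge p (m + 1) ⊕ (Fin q × Sphere (m + 1) × I) → Prop
  | cone (α : Fin q) (s s' : Sphere (m + 1)) : Glue K (Sum.inr (α, s, 0)) (Sum.inr (α, s', 0))
  | boundary (α : Fin q) (s : Sphere (m + 1)) :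
      Glue K (Sum.inr (α, s, 1)) (Sum.inl (K.attach α s))

/-- The underlying topological space `(S^{d-1} ∨ ⋯ ∨ S^{d-1}) ∪ (D^d ⊔ ⋯ ⊔ D^d)`. -/
def Space (K : CellComplex m p q) : Type := Quot K.Glue

instance (K : CellComplex m p q) : TopologicalSpace K.Space :=
  inferInstanceAs (TopologicalSpace (Quot K.Glue))

/-- The incidence numbers `⟨∂e_α, f_j⟩` of the `d`-cells and the `(d-1)`-cells: the degree of
`S^{d-1} → S^{d-1} ∨ ⋯ ∨ S^{d-1} → S^{d-1}`, the attaching map of `e_α` followed by the projection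
onto the `j`-th sphere. -/
structure Incidence (K : CellComplex m p q) where
  /-- The incidence number of the `d`-cell `α` and the `(d-1)`-cell `j`. -/
  num : Fin q → Fin p → ℤ
  hasDegree : ∀ α j, HasDegree ((Wedge.pinch j).comp (K.attach α)) (num α j)

end CellComplex

/-- The complex `X = (S^{d-1} ∨ S^{d-1}) ∪ (D^d ⊔ D^d)`, `d = m + 2`, whose two `d`-cells are both
attached by the `(d-2)`-fold suspension of the loop `x y⁻¹` in `S^1 ∨ S^1`. -/
def exampleComplex (m : ℕ) : CellComplex m 2 2 where
  attach _ := Wedge.suspend ((Wedge.circleLoop 0).trans (Wedge.circleLoop 1).symm) m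

/-! ### Cellular chains, the dynamical equation and the average current

Cellular `d`-chains with coefficients in `A` are functions `Fin q → A`, cellular `(d-1)`-chains are
functions `Fin p → A`; every `(d-1)`-chain is a cycle. -/

namespace CellComplex.Incidence

variable {m p q : ℕ} {K : CellComplex m p q} (b : K.Incidence)

/-- The matrix of the cellular boundary operator `C_d(X; A) → C_{d-1}(X; A)`. -/
def boundaryMatrix (A : Type) [CommRing A] : Matrix (Fin p) (Fin q) A :=
  Matrix.of fun j α => (b.num α j : A)

/-- The cellular boundary operator `∂ : C_d(X; A) → C_{d-1}(X; A)`. -/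
def boundary (A : Type) [CommRing A] : (Fin q → A) →ₗ[A] (Fin p → A) :=
  (b.boundaryMatrix A).mulVecLin

/-- The coboundary operator `∂^* : C_{d-1}(X; ℝ) → C_d(X; ℝ)`, the adjoint of `∂` in the standard
inner products. -/
def coboundary : (Fin p → ℝ) →ₗ[ℝ] (Fin q → ℝ) := (b.boundaryMatrix ℝ).transpose.mulVecLin

/-- The top cellular homology `H_d(X; A)`. As `X` has no `(d+1)`-cells, it is the module of
`d`-cycles. -/
def topHomology (A : Type) [CommRing A] : Submodule A (Fin q → A) := LinearMap.ker (b.boundary A)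

/-- The diagonal operator `e^{βE}` of a system of weights `E`. -/
def expWeight {k : ℕ} (β : ℝ) (E : Fin k → ℝ) : (Fin k → ℝ) →ₗ[ℝ] (Fin k → ℝ) :=
  (Matrix.diagonal fun i => Real.exp (β * E i)).mulVecLin

/-- The biased coboundary operator `∂^*_{E,W} = e^{-βW} ∂^* e^{βE}`. -/
def biasedCoboundary (β : ℝ) (E : Fin p → ℝ) (W : Fin q → ℝ) : (Fin p → ℝ) →ₗ[ℝ] (Fin q → ℝ) :=
  expWeight (-β) W ∘ₗ b.coboundary ∘ₗ expWeight β E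

/-- The biased Laplacian (dynamical operator) `H = ∂ e^{-βW} ∂^* e^{βE}`. -/
def dynamicalOperator (β : ℝ) (E : Fin p → ℝ) (W : Fin q → ℝ) : (Fin p → ℝ) →ₗ[ℝ] (Fin p → ℝ) :=
  b.boundary ℝ ∘ₗ b.biasedCoboundary β E W

/-- `ρ` is a `1`-periodic solution of the dynamical equation `ρ' = -τ H ρ`, for the `1`-periodic
protocol `(E, W)`, in the homology class of the integral cycle `z₀`. -/
structure IsPeriodicSolution (β τ : ℝ) (E : ℝ → Fin p → ℝ) (W : ℝ → Fin q → ℝ) (z₀ : Fin p → ℤ)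
    (ρ : ℝ → Fin p → ℝ) : Prop where
  hasDerivAt : ∀ t, HasDerivAt ρ (-(τ • b.dynamicalOperator β (E t) (W t) (ρ t))) t
  periodic : Function.Periodic ρ 1
  homologous : ∀ t, ρ t - (fun j => (z₀ j : ℝ)) ∈ LinearMap.range (b.boundary ℝ)

open Classical in
/-- The `1`-periodic solution of the dynamical equation (meaningful when it exists and is
unique). -/
def periodicSolution (β τ : ℝ) (E : ℝ → Fin p → ℝ) (W : ℝ → Fin q → ℝ) (z₀ : Fin p → ℤ) :
    ℝ → Fin p → ℝ :=
  if h : ∃ ρ, b.IsPeriodicSolution β τ E W z₀ ρ then h.choose else 0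

/-- The current density `J(t) = τ ∂^*_{E,W} ρ(t)`. -/
def currentDensity (β τ : ℝ) (E : ℝ → Fin p → ℝ) (W : ℝ → Fin q → ℝ) (z₀ : Fin p → ℤ) (t : ℝ) :
    Fin q → ℝ :=
  τ • b.biasedCoboundary β (E t) (W t) (b.periodicSolution β τ E W z₀ t)

/-- The average current `Q = ∫₀¹ J(t) dt`, a real `d`-chain. -/
def averageCurrent (β τ : ℝ) (E : ℝ → Fin p → ℝ) (W : ℝ → Fin q → ℝ) (z₀ : Fin p → ℤ) :
    Fin q → ℝ :=
  ∫ t in (0 : ℝ)..1, b.currentDensity β τ E W z₀ t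

end CellComplex.Incidence

end CycleFluctuation

end

/-!
The number of times the two `d`-cells wrap around each sphere is read off the loop `x y⁻¹`: after
projection to the first sphere its suspension is literally the concatenation of the identity with a
constant map, after projection to the second one the concatenation of a constant map with the
reversed identity (`sphereLoop_pinch_zero`, `sphereLoop_pinch_one`). So both columns of the boundary
matrix are `(1, -1)`, and the `d`-cycles are the multiples of `e₁ - e₂`.

A chain homologous to `f₁` has the form `r f₁ + (1 - r) f₂`, and for it the dynamical equation
becomes the scalar relaxation equation `r' = -τ a (r - p)` (`isPeriodicSolution_iff`), with a rate
`a ≥ 1` and the equilibrium value `p = e^{-βE} / (e^{βE} + e^{-βE})`. Variation of constants gives a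
periodic solution for every `τ > 0`; it is unique, and lies between `0` and `1`, because `r = p` at
its extrema. With `w = e^{-βW} / (e^{βW} + e^{-βW})` the current is `τ a (r - p) (w, 1 - w)`, that
is `-r' (w, 1 - w)`; its components add up to `-r'`, so the average current is the cycle
`q (e₁ - e₂)` with `q = -∫ w r' = ∫ w' r`.

The energy identity `τ ∫ a (r - p)² = -∫ p' r` shows that `r → p` in `L²` as `τ → ∞`, hence
`q → ∫ w' p` (`abs_integral_current_sub_le`). As `β → ∞`, `w` tends to `1` where `W < 0` and to `0`
where `W > 0`, so it jumps down at `1 / 2` and up at the integers, while `p` tends to `0` at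
`1 / 2` and to `1` at the integers. Only the upward jump counts, and `∫ w' p → 1`
(`tendsto_integral_gibbs`). No monotonicity of `W` is needed near its zeros: the product of
`|w'|` with the distance from `p` to its limit is `O(β e^{-2βη})`, uniformly in time.
-/

namespace CycleFluctuation

/-! ### Incidence numbers -/

theorem sphereLoop_apply {n : ℕ} (f : C(Sphere (n + 1), Sphere (n + 1)))
    (hf : f Wedge.base = Wedge.base) (u : Fin (n + 1) → I) :
    sphereLoop f hf u = f (Wedge.mk 0 u) := rfl

namespace Wedge

variable {p n : ℕ}

theorem pinch_mk (j i : Fin p) (u : Fin n → I) :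
    pinch j (mk i u) = mk 0 (if i = j then u else fun _ => 0) := rfl

theorem pinch_mk_self (j : Fin p) (u : Fin n → I) : pinch j (mk j u) = mk 0 u := by
  rw [pinch_mk, if_pos rfl]

theorem pinch_mk_of_ne {i j : Fin p} (h : i ≠ j) (u : Fin (n + 1) → I) :
    pinch j (mk i u) = base := by
  rw [pinch_mk, if_neg h]; rfl

theorem pinch_base [NeZero p] (j : Fin p) : pinch j (base : Wedge p (n + 1)) = base :=
  mk_eq_base (n := n) 0 (by split_ifs <;> exact ⟨0, Or.inl rfl⟩)

theorem suspend_mk [NeZero p] (g : Path (base : Wedge p 1) base) (i : Fin 1)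
    (u : Fin (n + 1) → I) : suspend g n (mk i u) = smash (g (u 0)) (Fin.tail u) := rfl

theorem smash_circleLoop [NeZero p] (i : Fin p) (t : I) (s : Fin n → I) :
    smash (circleLoop i t) s = mk i (Fin.cons t s) := rfl

theorem suspend_base [NeZero p] (g : Path (base : Wedge p 1) base) :
    suspend g n base = base := by
  rw [base, suspend_mk, g.source, smash_base]

theorem suspend_trans_mk [NeZero p] (g h : Path (base : Wedge p 1) base)
    (u : Fin (n + 1) → I) : suspend (g.trans h) n (mk 0 u) =
      if (u 0 : ℝ) ≤ 1 / 2 then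
        suspend g n (mk 0 (Function.update u 0 (projIcc 0 1 zero_le_one (2 * u 0))))
      else suspend h n (mk 0 (Function.update u 0 (projIcc 0 1 zero_le_one (2 * u 0 - 1)))) := by
  have ht : ∀ t : I, Fin.tail (Function.update u 0 t) = Fin.tail u := fun t => by
    ext i; simp [Fin.tail]
  simp only [suspend_mk, ht, Function.update_self, Path.trans_apply]
  split_ifs with h
  · rw [projIcc_of_mem]
  · rw [projIcc_of_mem]

theorem pinch_suspend_circleLoop_self [NeZero p] (j : Fin p) (u : Fin (n + 1) → I) :
    pinch j (suspend (circleLoop j) n (mk 0 u)) = mk 0 u := by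
  rw [suspend_mk, smash_circleLoop, Fin.cons_self_tail, pinch_mk_self]

theorem pinch_suspend_circleLoop_of_ne [NeZero p] {i j : Fin p} (h : i ≠ j)
    (u : Fin (n + 1) → I) : pinch j (suspend (circleLoop i) n (mk 0 u)) = base := by
  rw [suspend_mk, smash_circleLoop, pinch_mk_of_ne h]

theorem suspend_symm_mk [NeZero p] (g : Path (base : Wedge p 1) base) (u : Fin (n + 1) → I) :
    suspend g.symm n (mk 0 u) =
      suspend g n (mk 0 fun i => if i = 0 then unitInterval.symm (u 0) else u i) := by
  have ht : Fin.tail (fun i => if i = 0 then unitInterval.symm (u 0) else u i) = Fin.tail u := by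
    ext i; simp [Fin.tail]
  simp only [suspend_mk, ht, Path.symm_apply, if_true, Function.comp_apply]

end Wedge

open Wedge

/-- The suspended loop `x y⁻¹` followed by the projection onto the first sphere is the
concatenation of the identity with a constant map. -/
theorem sphereLoop_pinch_zero (m : ℕ) (α : Fin 2)
    (hf : (pinch 0).comp ((exampleComplex m).attach α) base = base) :
    sphereLoop ((pinch 0).comp ((exampleComplex m).attach α)) hf =
      GenLoop.transAt 0 (sphereLoop (ContinuousMap.id _) rfl) GenLoop.const := by
  ext u
  rw [sphereLoop_apply]
  change pinch 0 (suspend _ m (mk 0 u)) = ite _ (mk 0 _) base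
  rw [suspend_trans_mk]
  split_ifs with h
  · exact pinch_suspend_circleLoop_self _ _
  · rw [suspend_symm_mk]
    exact pinch_suspend_circleLoop_of_ne (by decide) _

/-- The suspended loop `x y⁻¹` followed by the projection onto the second sphere is the
concatenation of a constant map with the reversed identity. -/
theorem sphereLoop_pinch_one (m : ℕ) (α : Fin 2)
    (hf : (pinch 1).comp ((exampleComplex m).attach α) base = base) :
    sphereLoop ((pinch 1).comp ((exampleComplex m).attach α)) hf =
      GenLoop.transAt 0 GenLoop.const
        (GenLoop.symmAt 0 (sphereLoop (ContinuousMap.id _) rfl)) := by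
  ext u
  rw [sphereLoop_apply]
  change pinch 1 (suspend _ m (mk 0 u)) = ite _ base (mk 0 _)
  rw [suspend_trans_mk]
  split_ifs with h
  · exact pinch_suspend_circleLoop_of_ne (by decide) _
  · rw [suspend_symm_mk]
    exact pinch_suspend_circleLoop_self _ _

theorem hasDegree_pinch_zero (m : ℕ) (α : Fin 2) :
    HasDegree ((pinch 0).comp ((exampleComplex m).attach α)) 1 := by
  have hf : (pinch 0).comp ((exampleComplex m).attach α) base = base := by
    change pinch 0 (suspend _ m base) = base
    rw [suspend_base, pinch_base]
  refine ⟨hf, ?_⟩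
  rw [zpow_one, homotopyClass, sphereLoop_pinch_zero]
  refine HomotopyGroup.mul_spec.symm.trans ?_
  exact one_mul (M := HomotopyGroup (Fin (m + 1)) _ _) _

theorem hasDegree_pinch_one (m : ℕ) (α : Fin 2) :
    HasDegree ((pinch 1).comp ((exampleComplex m).attach α)) (-1) := by
  have hf : (pinch 1).comp ((exampleComplex m).attach α) base = base := by
    change pinch 1 (suspend _ m base) = base
    rw [suspend_base, pinch_base]
  refine ⟨hf, ?_⟩
  rw [zpow_neg_one, homotopyClass, sphereLoop_pinch_one]
  refine HomotopyGroup.mul_spec.symm.trans ?_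
  refine (mul_one (M := HomotopyGroup (Fin (m + 1)) _ _) _).trans ?_
  exact HomotopyGroup.inv_spec.symm

/-- The incidence numbers of the example: each `d`-cell has incidence `1` with the first
sphere and `-1` with the second. -/
def exampleIncidence (m : ℕ) : (exampleComplex m).Incidence where
  num _ := ![1, -1]
  hasDegree α j := by
    fin_cases j
    · exact hasDegree_pinch_zero m α
    · exact hasDegree_pinch_one m α

/-- The top homology of the example is the antidiagonal of the space of `d`-chains. -/
theorem mem_topHomology_iff (m : ℕ) {A : Type} [CommRing A] (x : Fin 2 → A) :
    x ∈ (exampleIncidence m).topHomology A ↔ x 0 + x 1 = 0 := by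
  rw [CellComplex.Incidence.topHomology, LinearMap.mem_ker]
  constructor
  · intro h
    simpa [CellComplex.Incidence.boundary, CellComplex.Incidence.boundaryMatrix, exampleIncidence,
      Matrix.mulVec, dotProduct, Fin.sum_univ_two] using congrFun h 0
  · intro h
    ext j
    fin_cases j <;> simp [CellComplex.Incidence.boundary, CellComplex.Incidence.boundaryMatrix,
      exampleIncidence, Matrix.mulVec, dotProduct, Fin.sum_univ_two]
    · exact h
    · linear_combination -h

/-- `H_d(X; ℤ)` is identified with `ℤ` by the coefficient of the first `d`-cell. -/
def topHomologyEquiv (m : ℕ) : (exampleIncidence m).topHomology ℤ ≃ₗ[ℤ] ℤ where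
  toFun x := x.1 0
  map_add' _ _ := rfl
  map_smul' _ _ := rfl
  invFun n := ⟨![n, -n], (mem_topHomology_iff m _).2 (by simp)⟩
  left_inv x := by
    have := (mem_topHomology_iff m _).1 x.2
    ext j
    fin_cases j
    · simp
    · simp; linarith
  right_inv n := by simp

/-! ### Periodic solutions of the scalar relaxation equation -/

/-- At a maximum of `u` the equation gives `u = p`, whence the bound. -/
theorem le_of_periodic_relaxation {u a p : ℝ → ℝ} {M : ℝ} (hper : Function.Periodic u 1)
    (ha : ∀ t, 0 < a t) (hu : ∀ t, HasDerivAt u (-(a t * (u t - p t))) t) (hp : ∀ t, p t ≤ M)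
    (t : ℝ) : u t ≤ M := by
  have hc : Continuous u := continuous_iff_continuousAt.2 fun t => (hu t).continuousAt
  obtain ⟨x, -, hx⟩ := isCompact_Icc.exists_isMaxOn (s := Icc (0 : ℝ) 1) ⟨0, by simp⟩
    hc.continuousOn
  have hmax : ∀ s, u s ≤ u x := fun s => by
    obtain ⟨y, hy, he⟩ := hper.exists_mem_Ico₀ one_pos s
    rw [he]
    exact hx ⟨hy.1, hy.2.le⟩
  have h0 := IsLocalMax.hasDerivAt_eq_zero (Eventually.of_forall hmax) (hu x)
  have hx' : u x = p x := by
    rcases mul_eq_zero.1 (neg_eq_zero.1 h0) with h | h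
    · exact absurd h (ha x).ne'
    · linarith
  exact (hmax t).trans (hx' ▸ hp x)

theorem ge_of_periodic_relaxation {u a p : ℝ → ℝ} {M : ℝ} (hper : Function.Periodic u 1)
    (ha : ∀ t, 0 < a t) (hu : ∀ t, HasDerivAt u (-(a t * (u t - p t))) t) (hp : ∀ t, M ≤ p t)
    (t : ℝ) : M ≤ u t := by
  have := le_of_periodic_relaxation (u := fun t => -u t) (a := a) (p := fun t => -p t) (M := -M)
    (fun t => congrArg Neg.neg (hper t)) ha
    (fun t => (hu t).neg.congr_deriv (by ring)) (fun t => neg_le_neg (hp t)) t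
  linarith

theorem periodic_relaxation_unique {u v a p : ℝ → ℝ} (hu : Function.Periodic u 1)
    (hv : Function.Periodic v 1) (ha : ∀ t, 0 < a t)
    (hu' : ∀ t, HasDerivAt u (-(a t * (u t - p t))) t)
    (hv' : ∀ t, HasDerivAt v (-(a t * (v t - p t))) t) : u = v := by
  have hd : ∀ t, HasDerivAt (fun t => u t - v t) (-(a t * ((u t - v t) - 0))) t := fun t =>
    ((hu' t).sub (hv' t)).congr_deriv (by ring)
  have hper : Function.Periodic (fun t => u t - v t) 1 := hu.sub hv
  ext t
  have h1 := le_of_periodic_relaxation (p := fun _ => 0) hper ha hd (fun _ => le_rfl) t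
  have h2 := ge_of_periodic_relaxation (p := fun _ => 0) hper ha hd (fun _ => le_rfl) t
  linarith

/-- Variation of constants: with `A = ∫₀ a` and `G = ∫₀ e^A a p`, every `e^{-A} (r₀ + G)` is a
solution, and `r₀ = G(1) / (e^{A(1)} - 1)` is the initial value that makes it periodic. -/
theorem exists_periodic_relaxation {a p : ℝ → ℝ} (ha : Continuous a) (hp : Continuous p)
    (hpa : Function.Periodic a 1) (hpp : Function.Periodic p 1) (hpos : ∀ t, 0 < a t) :
    ∃ u : ℝ → ℝ, Function.Periodic u 1 ∧ ∀ t, HasDerivAt u (-(a t * (u t - p t))) t := by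
  set A : ℝ → ℝ := fun t => ∫ s in (0 : ℝ)..t, a s with hA
  have hA' : ∀ t, HasDerivAt A (a t) t := fun t =>
    intervalIntegral.integral_hasDerivAt_right (ha.intervalIntegrable _ _)
      ha.aestronglyMeasurable.stronglyMeasurableAtFilter ha.continuousAt
  have hAc : Continuous A := continuous_iff_continuousAt.2 fun t => (hA' t).continuousAt
  set g : ℝ → ℝ := fun t => Real.exp (A t) * (a t * p t) with hg
  have hgc : Continuous g := (Real.continuous_exp.comp hAc).mul (ha.mul hp)
  set G : ℝ → ℝ := fun t => ∫ s in (0 : ℝ)..t, g s with hG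
  have hG' : ∀ t, HasDerivAt G (g t) t := fun t =>
    intervalIntegral.integral_hasDerivAt_right (hgc.intervalIntegrable _ _)
      hgc.aestronglyMeasurable.stronglyMeasurableAtFilter hgc.continuousAt
  have hA1 : 0 < A 1 :=
    intervalIntegral.intervalIntegral_pos_of_pos (ha.intervalIntegrable _ _) hpos one_pos
  have hAper : ∀ t, A (t + 1) = A t + A 1 := fun t => by
    have h1 : A (t + 1) = A 1 + ∫ s in (1 : ℝ)..(t + 1), a s :=
      (intervalIntegral.integral_add_adjacent_intervals (ha.intervalIntegrable _ _)
        (ha.intervalIntegrable _ _)).symm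
    have h2 := intervalIntegral.integral_comp_add_right (a := 0) (b := t) a 1
    simp only [zero_add, hpa _] at h2
    rw [h1, ← h2, add_comm]
  have hgper : ∀ t, g (t + 1) = Real.exp (A 1) * g t := fun t => by
    simp only [hg, hAper, hpa t, hpp t, Real.exp_add]
    ring
  have hGper : ∀ t, G (t + 1) = G 1 + Real.exp (A 1) * G t := fun t => by
    have h1 : G (t + 1) = G 1 + ∫ s in (1 : ℝ)..(t + 1), g s :=
      (intervalIntegral.integral_add_adjacent_intervals (hgc.intervalIntegrable _ _)
        (hgc.intervalIntegrable _ _)).symm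
    have h2 := intervalIntegral.integral_comp_add_right (a := 0) (b := t) g 1
    simp only [zero_add, hgper, intervalIntegral.integral_const_mul] at h2
    rw [h1, ← h2]
  have hne : Real.exp (A 1) - 1 ≠ 0 := by
    have := Real.one_lt_exp_iff.2 hA1
    linarith
  refine ⟨fun t => Real.exp (-A t) * (G 1 / (Real.exp (A 1) - 1) + G t), fun t => ?_, fun t => ?_⟩
  · have he := Real.exp_pos (A 1)
    simp only [hAper, hGper, neg_add, Real.exp_add, Real.exp_neg (A 1)]
    field_simp
    ring
  · refine ((hA' t).neg.exp.mul ((hG' t).const_add _)).congr_deriv ?_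
    have he : Real.exp (-A t) * Real.exp (A t) = 1 := by rw [← Real.exp_add]; simp
    simp only [hg]
    linear_combination (a t * p t) * he

/-- Energy estimate: multiply `r' = -τ a (r - p)` by `r - p` and integrate over a period. -/
theorem integral_sq_sub_le {r a p p' : ℝ → ℝ} {τ C : ℝ} (hτ : 0 < τ)
    (hr : ∀ t, HasDerivAt r (-(τ * a t * (r t - p t))) t) (hr01 : r 1 = r 0)
    (hr0 : ∀ t, 0 ≤ r t) (hr1 : ∀ t, r t ≤ 1) (ha : Continuous a) (ha1 : ∀ t, 1 ≤ a t)
    (hp : ContinuousOn p (Icc 0 1)) (hp01 : p 1 = p 0) (hp' : ContinuousOn p' (Icc 0 1))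
    (hpd : ∀ t ∈ Ioo (0 : ℝ) 1, HasDerivAt p (p' t) t) (hC : ∀ t ∈ Icc (0 : ℝ) 1, |p' t| ≤ C) :
    ∫ t in (0 : ℝ)..1, (r t - p t) ^ 2 ≤ C / τ := by
  have hrc : ContinuousOn r (Icc 0 1) := fun t _ => (hr t).continuousAt.continuousWithinAt
  have hac := ha.continuousOn (s := Icc (0 : ℝ) 1)
  have h1 : ∫ t in (0 : ℝ)..1, (-(τ * (a t * (r t - p t) ^ 2)) - p' t * r t) = 0 := by
    rw [intervalIntegral.integral_eq_sub_of_hasDerivAt_of_le (f := fun t => r t ^ 2 / 2 - p t * r t)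
      zero_le_one (by fun_prop) (fun t ht => ?_)
      (ContinuousOn.intervalIntegrable_of_Icc zero_le_one (by fun_prop))]
    · rw [hr01, hp01, sub_self]
    · refine ((((hr t).pow 2).div_const 2).sub ((hpd t ht).mul (hr t))).congr_deriv ?_
      norm_num
      ring
  have h2 : ∫ t in (0 : ℝ)..1, τ * (r t - p t) ^ 2 ≤
      ∫ t in (0 : ℝ)..1, (C - (-(τ * (a t * (r t - p t) ^ 2)) - p' t * r t)) := by
    refine intervalIntegral.integral_mono_on zero_le_one
      (ContinuousOn.intervalIntegrable_of_Icc zero_le_one (by fun_prop))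
      (ContinuousOn.intervalIntegrable_of_Icc zero_le_one (by fun_prop)) fun t ht => ?_
    have h3 : τ * (r t - p t) ^ 2 ≤ τ * (a t * (r t - p t) ^ 2) :=
      mul_le_mul_of_nonneg_left (le_mul_of_one_le_left (sq_nonneg _) (ha1 t)) hτ.le
    have h4 : |p' t * r t| ≤ C := by
      rw [abs_mul, abs_of_nonneg (hr0 t)]
      exact (mul_le_of_le_one_right (abs_nonneg _) (hr1 t)).trans (hC t ht)
    linarith [neg_le_of_abs_le h4]
  rw [intervalIntegral.integral_sub intervalIntegrable_const
    (ContinuousOn.intervalIntegrable_of_Icc zero_le_one (by fun_prop)), h1,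
    intervalIntegral.integral_const_mul] at h2
  rw [le_div_iff₀' hτ]
  simpa using h2

/-- The adiabatic estimate: the weighted current `∫ w τ a (r - p)` of a periodic solution is
`∫ w' p` up to an error of order `τ^{-1/2}`. Integration by parts turns it into `∫ w' r`, and
`r - p` is small in `L²` by the energy estimate. -/
theorem abs_integral_current_sub_le {r a p p' w w' : ℝ → ℝ} {τ C D : ℝ} (hτ : 0 < τ)
    (hr : ∀ t, HasDerivAt r (-(τ * a t * (r t - p t))) t) (hr01 : r 1 = r 0)
    (hr0 : ∀ t, 0 ≤ r t) (hr1 : ∀ t, r t ≤ 1) (ha : Continuous a) (ha1 : ∀ t, 1 ≤ a t)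
    (hp : ContinuousOn p (Icc 0 1)) (hp01 : p 1 = p 0) (hp' : ContinuousOn p' (Icc 0 1))
    (hpd : ∀ t ∈ Ioo (0 : ℝ) 1, HasDerivAt p (p' t) t) (hC : ∀ t ∈ Icc (0 : ℝ) 1, |p' t| ≤ C)
    (hw : ContinuousOn w (Icc 0 1)) (hw01 : w 1 = w 0) (hw' : ContinuousOn w' (Icc 0 1))
    (hwd : ∀ t ∈ Ioo (0 : ℝ) 1, HasDerivAt w (w' t) t) (hD : ∀ t ∈ Icc (0 : ℝ) 1, |w' t| ≤ D) :
    |(∫ t in (0 : ℝ)..1, w t * (τ * a t * (r t - p t))) - ∫ t in (0 : ℝ)..1, w' t * p t| ≤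
      D * (1 + C) / 2 / √τ := by
  have hrc : ContinuousOn r (Icc 0 1) := fun t _ => (hr t).continuousAt.continuousWithinAt
  have hac := ha.continuousOn (s := Icc (0 : ℝ) 1)
  have hint : ∀ {f : ℝ → ℝ}, ContinuousOn f (Icc 0 1) →
      IntervalIntegrable f MeasureTheory.volume 0 1 :=
    fun h => ContinuousOn.intervalIntegrable_of_Icc zero_le_one h
  have hparts : ∫ t in (0 : ℝ)..1, (w' t * r t - w t * (τ * a t * (r t - p t))) = 0 := by
    rw [intervalIntegral.integral_eq_sub_of_hasDerivAt_of_le (f := fun t => w t * r t)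
      zero_le_one (by fun_prop) (fun t ht => ?_) (hint (by fun_prop))]
    · rw [hr01, hw01, sub_self]
    · exact ((hwd t ht).mul (hr t)).congr_deriv (by ring)
  have heq : (∫ t in (0 : ℝ)..1, w t * (τ * a t * (r t - p t))) - ∫ t in (0 : ℝ)..1, w' t * p t =
      ∫ t in (0 : ℝ)..1, w' t * (r t - p t) := by
    rw [intervalIntegral.integral_sub (hint (by fun_prop)) (hint (by fun_prop))] at hparts
    simp only [mul_sub (w' _)]
    rw [intervalIntegral.integral_sub (hint (by fun_prop)) (hint (by fun_prop))]
    linarith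
  have hs : 0 < √τ := Real.sqrt_pos.2 hτ
  have hss : √τ * √τ = τ := Real.mul_self_sqrt hτ.le
  have hD0 : 0 ≤ D := (abs_nonneg _).trans (hD 0 (by simp))
  have hE := integral_sq_sub_le hτ hr hr01 hr0 hr1 ha ha1 hp hp01 hp' hpd hC
  -- the inequality `2 |y| ≤ s⁻¹ + s y²` replaces Cauchy–Schwarz; `s = √τ` balances the two terms
  have hyoung : ∀ y : ℝ, |y| ≤ ((√τ)⁻¹ + √τ * y ^ 2) / 2 := fun y => by
    have h : 0 ≤ (√τ * |y| - 1) ^ 2 / √τ := by positivity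
    have h2 : (√τ * |y| - 1) ^ 2 / √τ = (√τ)⁻¹ + √τ * y ^ 2 - 2 * |y| := by
      rw [← sq_abs y]
      field_simp
      ring
    linarith
  rw [heq]
  calc |∫ t in (0 : ℝ)..1, w' t * (r t - p t)|
      ≤ ∫ t in (0 : ℝ)..1, |w' t * (r t - p t)| :=
        intervalIntegral.abs_integral_le_integral_abs zero_le_one
    _ ≤ ∫ t in (0 : ℝ)..1, D * (((√τ)⁻¹ + √τ * (r t - p t) ^ 2) / 2) := by
        refine intervalIntegral.integral_mono_on zero_le_one (hint (by fun_prop))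
          (hint (by fun_prop)) fun t ht => ?_
        rw [abs_mul]
        exact mul_le_mul (hD t ht) (hyoung _) (abs_nonneg _) hD0
    _ = D * (((√τ)⁻¹ + √τ * ∫ t in (0 : ℝ)..1, (r t - p t) ^ 2) / 2) := by
        rw [intervalIntegral.integral_const_mul, intervalIntegral.integral_div,
          intervalIntegral.integral_add intervalIntegrable_const (hint (by fun_prop)),
          intervalIntegral.integral_const_mul]
        simp
    _ ≤ D * (((√τ)⁻¹ + √τ * (C / τ)) / 2) := by gcongr
    _ = D * (1 + C) / 2 / √τ := by
        nth_rewrite 3 [← hss]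
        field_simp

/-! ### Equilibrium weights and the low temperature limit -/

/-- The equilibrium probability `e^{-βx} / (e^{βx} + e^{-βx})` of the first of two states with
energies `x` and `-x`, written through the logistic function. -/
noncomputable def gibbs (β x : ℝ) : ℝ := Real.sigmoid (-(2 * β * x))

theorem gibbs_mul_add (β x : ℝ) :
    gibbs β x * (Real.exp (β * x) + Real.exp (-(β * x))) = Real.exp (-(β * x)) := by
  have h : Real.exp (2 * β * x) * Real.exp (-(β * x)) = Real.exp (β * x) := by
    rw [← Real.exp_add]; ring_nf
  rw [← h, gibbs, Real.sigmoid_def, neg_neg]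
  have := Real.exp_pos (2 * β * x)
  field_simp
  ring

theorem gibbs_nonneg (β x : ℝ) : 0 ≤ gibbs β x := Real.sigmoid_nonneg _

theorem gibbs_le_one (β x : ℝ) : gibbs β x ≤ 1 := Real.sigmoid_le_one _

theorem continuous_gibbs (β : ℝ) : Continuous (gibbs β) :=
  continuous_sigmoid.comp (by fun_prop)

theorem hasDerivAt_gibbs_comp {f : ℝ → ℝ} {f' t : ℝ} (β : ℝ) (hf : HasDerivAt f f' t) :
    HasDerivAt (fun t => gibbs β (f t))
      (-(2 * β * f') * (gibbs β (f t) * (1 - gibbs β (f t)))) t := by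
  have := (Real.hasDerivAt_sigmoid (-(2 * β * f t))).comp t (hf.const_mul (2 * β)).neg
  exact this.congr_deriv (mul_comm _ _)

theorem sigmoid_le_exp (x : ℝ) : Real.sigmoid x ≤ Real.exp x := by
  have h := Real.sigmoid_mul_rexp_neg (-x)
  rw [neg_neg] at h
  rw [← h]
  exact mul_le_of_le_one_left (Real.exp_pos _).le (Real.sigmoid_le_one _)

theorem gibbs_le_exp (β x : ℝ) : gibbs β x ≤ Real.exp (-(2 * β * x)) := sigmoid_le_exp _

theorem one_sub_gibbs (β x : ℝ) : 1 - gibbs β x = gibbs β (-x) := by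
  rw [gibbs, gibbs, ← Real.sigmoid_neg]; ring_nf

theorem gibbs_mul_one_sub_le (β x : ℝ) :
    gibbs β x * (1 - gibbs β x) ≤ Real.exp (-(2 * β * |x|)) := by
  have h0 := gibbs_nonneg β x
  have h0' := gibbs_nonneg β (-x)
  have h1 := gibbs_le_one β x
  have h1' := gibbs_le_one β (-x)
  rw [one_sub_gibbs]
  rcases abs_cases x with ⟨h, -⟩ | ⟨h, -⟩ <;> rw [h]
  · exact (mul_le_of_le_one_right h0 h1').trans (gibbs_le_exp _ _)
  · exact (mul_le_of_le_one_left h0' h1).trans (gibbs_le_exp _ _)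

theorem tendsto_gibbs_of_pos {x : ℝ} (hx : 0 < x) : Tendsto (fun β => gibbs β x) atTop (𝓝 0) := by
  refine Real.tendsto_sigmoid_atBot.comp (tendsto_neg_atTop_atBot.comp ?_)
  simp only [mul_right_comm (2 : ℝ)]
  exact tendsto_id.const_mul_atTop (by positivity)

theorem tendsto_gibbs_of_neg {x : ℝ} (hx : x < 0) : Tendsto (fun β => gibbs β x) atTop (𝓝 1) := by
  have := (tendsto_gibbs_of_pos (neg_pos.2 hx)).const_sub 1
  simpa [one_sub_gibbs] using this

theorem tendsto_mul_exp_neg_mul {η : ℝ} (hη : 0 < η) (c : ℝ) :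
    Tendsto (fun β => c * β * Real.exp (-(2 * β * η))) atTop (𝓝 0) := by
  have h1 : Tendsto (fun β : ℝ => 2 * η * β) atTop atTop :=
    tendsto_id.const_mul_atTop (by positivity)
  have h2 := ((Real.tendsto_pow_mul_exp_neg_atTop_nhds_zero 1).comp h1).const_mul (c / (2 * η))
  rw [mul_zero] at h2
  refine h2.congr fun β => ?_
  simp only [Function.comp, pow_one]
  rw [show 2 * η * β = 2 * β * η by ring]
  field_simp

/-- At every time either the slope of `gibbs β (W t)` is exponentially small (where `W ≠ 0`) or
`gibbs β (E t)` is exponentially close to `0` (where `E > 0`); compactness makes this uniform. -/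
theorem exists_abs_mul_gibbs_le {E W W' : ℝ → ℝ} {u v M : ℝ} (huv : u ≤ v)
    (hE : ContinuousOn E (Icc u v)) (hW : ContinuousOn W (Icc u v))
    (hM : ∀ t ∈ Icc u v, |W' t| ≤ M) (hpos : ∀ t ∈ Icc u v, W t = 0 → 0 < E t) :
    ∃ η > 0, ∀ β > 0, ∀ t ∈ Icc u v,
      |-(2 * β * W' t) * (gibbs β (W t) * (1 - gibbs β (W t))) * gibbs β (E t)| ≤
        2 * M * β * Real.exp (-(2 * β * η)) := by
  obtain ⟨x, hx, hmin⟩ := isCompact_Icc.exists_isMinOn (nonempty_Icc.2 huv)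
    (f := fun t => max |W t| (E t)) (by fun_prop)
  refine ⟨max |W x| (E x), ?_, fun β hβ t ht => ?_⟩
  · by_cases h : W x = 0
    · exact lt_max_of_lt_right (hpos x hx h)
    · exact lt_max_of_lt_left (abs_pos.2 h)
  have hη : max |W x| (E x) ≤ max |W t| (E t) := hmin ht
  set η := max |W x| (E x)
  have h0 := gibbs_nonneg β (W t)
  have h1 : 0 ≤ 1 - gibbs β (W t) := sub_nonneg.2 (gibbs_le_one _ _)
  have h1' : 1 - gibbs β (W t) ≤ 1 := sub_le_self _ h0
  have h2 := gibbs_nonneg β (E t)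
  have key : gibbs β (W t) * (1 - gibbs β (W t)) * gibbs β (E t) ≤ Real.exp (-(2 * β * η)) := by
    rcases le_max_iff.1 hη with h | h
    · refine (mul_le_of_le_one_right (mul_nonneg h0 h1) (gibbs_le_one _ _)).trans
        ((gibbs_mul_one_sub_le _ _).trans (Real.exp_le_exp.2 ?_))
      have := mul_le_mul_of_nonneg_left h (by positivity : 0 ≤ 2 * β)
      linarith
    · refine (mul_le_of_le_one_left h2 (mul_le_one₀ (gibbs_le_one _ _) h1 h1')).trans
        ((gibbs_le_exp _ _).trans (Real.exp_le_exp.2 ?_))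
      have := mul_le_mul_of_nonneg_left h (by positivity : 0 ≤ 2 * β)
      linarith
  rw [mul_assoc, abs_mul, abs_of_nonneg (mul_nonneg (mul_nonneg h0 h1) h2), abs_neg, abs_mul,
    abs_of_pos (by positivity : 0 < 2 * β)]
  calc 2 * β * |W' t| * _ ≤ 2 * β * M * Real.exp (-(2 * β * η)) := by
        gcongr
        · exact mul_nonneg (by positivity) ((abs_nonneg _).trans (hM t ht))
        · exact hM t ht
    _ = _ := by ring

theorem tendsto_integral_gibbs_of_pos {E W W' : ℝ → ℝ} {u v : ℝ} (huv : u ≤ v)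
    (hE : ContinuousOn E (Icc u v)) (hW : ContinuousOn W (Icc u v))
    (hW' : ContinuousOn W' (Icc u v))
    (hpos : ∀ t ∈ Icc u v, W t = 0 → 0 < E t) :
    Tendsto (fun β => ∫ t in u..v,
      -(2 * β * W' t) * (gibbs β (W t) * (1 - gibbs β (W t))) * gibbs β (E t)) atTop (𝓝 0) := by
  obtain ⟨M, hM⟩ := isCompact_Icc.exists_bound_of_continuousOn hW'
  obtain ⟨η, hη, h⟩ := exists_abs_mul_gibbs_le huv hE hW hM hpos
  have hlim := (tendsto_mul_exp_neg_mul hη (2 * M)).mul_const |v - u|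
  rw [zero_mul] at hlim
  refine squeeze_zero_norm' ?_ hlim
  filter_upwards [eventually_gt_atTop 0] with β hβ
  refine intervalIntegral.norm_integral_le_of_norm_le_const fun t ht => h β hβ t ?_
  rw [uIoc_of_le huv] at ht
  exact Ioc_subset_Icc_self ht

theorem tendsto_integral_gibbs_of_neg {E W W' : ℝ → ℝ} {u v : ℝ} (huv : u ≤ v)
    (hE : ContinuousOn E (Icc u v)) (hW : ContinuousOn W (Icc u v))
    (hW' : ContinuousOn W' (Icc u v))
    (hd : ∀ t ∈ Ioo u v, HasDerivAt W (W' t) t)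
    (hneg : ∀ t ∈ Icc u v, W t = 0 → E t < 0) :
    Tendsto (fun β => (∫ t in u..v,
      -(2 * β * W' t) * (gibbs β (W t) * (1 - gibbs β (W t))) * gibbs β (E t)) -
        (gibbs β (W v) - gibbs β (W u))) atTop (𝓝 0) := by
  have h := (tendsto_integral_gibbs_of_pos (E := fun t => -E t) huv hE.neg hW hW'
    (fun t ht h0 => neg_pos.2 (hneg t ht h0))).neg
  rw [neg_zero] at h
  refine h.congr fun β => ?_
  have hg : ContinuousOn (fun t => gibbs β (W t)) (Icc u v) :=
    (continuous_gibbs β).comp_continuousOn hW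
  have hgE : ContinuousOn (fun t => gibbs β (E t)) (Icc u v) :=
    (continuous_gibbs β).comp_continuousOn hE
  rw [← intervalIntegral.integral_eq_sub_of_hasDerivAt_of_le huv hg
    (fun t ht => hasDerivAt_gibbs_comp β (hd t ht))
    (ContinuousOn.intervalIntegrable_of_Icc huv (by fun_prop)),
    ← intervalIntegral.integral_sub (ContinuousOn.intervalIntegrable_of_Icc huv (by fun_prop))
      (ContinuousOn.intervalIntegrable_of_Icc huv (by fun_prop)), ← intervalIntegral.integral_neg]
  refine intervalIntegral.integral_congr fun t _ => ?_
  simp only [← one_sub_gibbs β (E t)]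
  ring

/-- The low temperature limit: `gibbs β (W t)` crosses from `1` to `0` while `gibbs β (E t)` is
close to `0`, and from `0` to `1` (around the integers) while `gibbs β (E t)` is close to `1`. -/
theorem tendsto_integral_gibbs {E W W' : ℝ → ℝ}
    (hE : ContinuousOn E (Icc 0 1)) (hW : ContinuousOn W (Icc 0 1))
    (hW' : ContinuousOn W' (Icc 0 1))
    (hd : ∀ t ∈ Ioo (0 : ℝ) 1, HasDerivAt W (W' t) t) (hW01 : W 1 = W 0)
    (hWneg : ∀ t ∈ Ioo (0 : ℝ) (1 / 2), W t < 0) (hWpos : ∀ t ∈ Ioo (1 / 2 : ℝ) 1, 0 < W t)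
    (hE0 : E 0 < 0) (hE1 : E 1 < 0) (hE2 : 0 < E (1 / 2)) :
    Tendsto (fun β => ∫ t in (0 : ℝ)..1,
      -(2 * β * W' t) * (gibbs β (W t) * (1 - gibbs β (W t))) * gibbs β (E t)) atTop (𝓝 1) := by
  have hz : ∀ t ∈ Icc (0 : ℝ) 1, W t = 0 → t = 0 ∨ t = 1 / 2 ∨ t = 1 := by
    intro t ht h
    by_contra! hne
    rcases lt_or_gt_of_ne hne.2.1 with h' | h'
    · exact (hWneg t ⟨lt_of_le_of_ne ht.1 hne.1.symm, h'⟩).ne h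
    · exact (hWpos t ⟨h', lt_of_le_of_ne ht.2 hne.2.2⟩).ne' h
  -- each of the three intervals cut out by `1 / 4` and `3 / 4` contains zeros of `W` of one sign
  -- of `E` only, and `W` does not vanish at the cuts
  have s1 : Icc (0 : ℝ) (1 / 4) ⊆ Icc 0 1 := Icc_subset_Icc le_rfl (by norm_num)
  have s2 : Icc (1 / 4 : ℝ) (3 / 4) ⊆ Icc 0 1 := Icc_subset_Icc (by norm_num) (by norm_num)
  have s3 : Icc (3 / 4 : ℝ) 1 ⊆ Icc 0 1 := Icc_subset_Icc (by norm_num) le_rfl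
  have l1 := tendsto_integral_gibbs_of_neg (by norm_num) (hE.mono s1) (hW.mono s1) (hW'.mono s1)
    (fun t ht => hd t ⟨ht.1, by linarith [ht.2]⟩) (fun t ht h => by
      rcases hz t (s1 ht) h with rfl | rfl | rfl
      · exact hE0
      · norm_num at ht
      · norm_num at ht)
  have l2 := tendsto_integral_gibbs_of_pos (by norm_num) (hE.mono s2) (hW.mono s2) (hW'.mono s2)
    (fun t ht h => by
      rcases hz t (s2 ht) h with rfl | rfl | rfl
      · norm_num at ht
      · exact hE2
      · norm_num at ht)
  have l3 := tendsto_integral_gibbs_of_neg (by norm_num) (hE.mono s3) (hW.mono s3) (hW'.mono s3)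
    (fun t ht => hd t ⟨by linarith [ht.1], ht.2⟩) (fun t ht h => by
      rcases hz t (s3 ht) h with rfl | rfl | rfl
      · norm_num at ht
      · norm_num at ht
      · exact hE1)
  have l4 := tendsto_gibbs_of_neg (hWneg (1 / 4) (by norm_num))
  have l5 := tendsto_gibbs_of_pos (hWpos (3 / 4) (by norm_num))
  have := (((l1.add l2).add l3).add l4).sub l5
  norm_num only at this
  refine this.congr fun β => ?_
  have hi : ∀ {x y : ℝ}, x ≤ y → Icc x y ⊆ Icc (0 : ℝ) 1 → IntervalIntegrable
      (fun t => -(2 * β * W' t) * (gibbs β (W t) * (1 - gibbs β (W t))) * gibbs β (E t))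
      MeasureTheory.volume x y := fun hxy hs => by
    have hg := ((continuous_gibbs β).comp_continuousOn hW).mono hs
    have hgE := ((continuous_gibbs β).comp_continuousOn hE).mono hs
    have := hW'.mono hs
    simp only [Function.comp_def] at hg hgE
    exact ContinuousOn.intervalIntegrable_of_Icc hxy (by fun_prop)
  rw [← intervalIntegral.integral_add_adjacent_intervals
    ((hi (by norm_num) s1).trans (hi (by norm_num) s2)) (hi (by norm_num) s3),
    ← intervalIntegral.integral_add_adjacent_intervals (hi (by norm_num) s1) (hi (by norm_num) s2),
    hW01]
  ring

/-! ### Reduction of the dynamical equation to a scalar equation -/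

theorem exampleIncidence_boundary (m : ℕ) (c : Fin 2 → ℝ) :
    (exampleIncidence m).boundary ℝ c = ![c 0 + c 1, -(c 0 + c 1)] := by
  ext j
  fin_cases j <;>
    simp [CellComplex.Incidence.boundary, CellComplex.Incidence.boundaryMatrix, exampleIncidence,
      Matrix.mulVec, dotProduct, Fin.sum_univ_two]

theorem mem_range_boundary_iff (m : ℕ) (x : Fin 2 → ℝ) :
    x ∈ LinearMap.range ((exampleIncidence m).boundary ℝ) ↔ x 0 + x 1 = 0 := by
  constructor
  · rintro ⟨c, rfl⟩
    simp [exampleIncidence_boundary]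
  · intro h
    refine ⟨![x 0, 0], ?_⟩
    rw [exampleIncidence_boundary]
    ext j
    fin_cases j
    · simp
    · simp; linarith

theorem expWeight_apply {k : ℕ} (β : ℝ) (E v : Fin k → ℝ) (i : Fin k) :
    CellComplex.Incidence.expWeight β E v i = Real.exp (β * E i) * v i :=
  Matrix.mulVec_diagonal (fun i => Real.exp (β * E i)) v i

theorem exampleIncidence_coboundary (m : ℕ) (v : Fin 2 → ℝ) (i : Fin 2) :
    (exampleIncidence m).coboundary v i = v 0 - v 1 := by
  simp [CellComplex.Incidence.coboundary, CellComplex.Incidence.boundaryMatrix, exampleIncidence,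
    Matrix.vecMul, dotProduct, Fin.sum_univ_two, sub_eq_add_neg]

theorem biasedCoboundary_apply (m : ℕ) (β x y : ℝ) (ρ : Fin 2 → ℝ) :
    (exampleIncidence m).biasedCoboundary β ![x, -x] ![y, -y] ρ =
      ![Real.exp (-(β * y)) * (Real.exp (β * x) * ρ 0 - Real.exp (-(β * x)) * ρ 1),
        Real.exp (β * y) * (Real.exp (β * x) * ρ 0 - Real.exp (-(β * x)) * ρ 1)] := by
  ext j
  rw [CellComplex.Incidence.biasedCoboundary, LinearMap.comp_apply, expWeight_apply,
    LinearMap.comp_apply, exampleIncidence_coboundary, expWeight_apply, expWeight_apply]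
  fin_cases j <;> simp

/-- The rate at which the first coefficient of a solution relaxes to its equilibrium value. -/
noncomputable def rate (β x y : ℝ) : ℝ :=
  (Real.exp (β * x) + Real.exp (-(β * x))) * (Real.exp (β * y) + Real.exp (-(β * y)))

theorem one_le_rate (β x y : ℝ) : 1 ≤ rate β x y := by
  have h : ∀ z : ℝ, 1 ≤ Real.exp z + Real.exp (-z) := fun z => by
    linarith [Real.add_one_le_exp z, Real.add_one_le_exp (-z)]
  exact one_le_mul_of_one_le_of_one_le (h _) (h _)

theorem biasedCoboundary_apply_of_sum_eq_one (m : ℕ) (β x y r : ℝ) :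
    (exampleIncidence m).biasedCoboundary β ![x, -x] ![y, -y] ![r, 1 - r] =
      ![gibbs β y * (rate β x y * (r - gibbs β x)),
        (1 - gibbs β y) * (rate β x y * (r - gibbs β x))] := by
  have hx := gibbs_mul_add β x
  have hy := gibbs_mul_add β y
  rw [biasedCoboundary_apply]
  have hk : Real.exp (β * x) * r - Real.exp (-(β * x)) * (1 - r) =
      (Real.exp (β * x) + Real.exp (-(β * x))) * (r - gibbs β x) := by
    linear_combination hx
  ext j
  fin_cases j
  · simp only [rate, Fin.zero_eta, Matrix.cons_val_zero, Matrix.cons_val_one, hk]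
    linear_combination -(Real.exp (β * x) + Real.exp (-(β * x))) * (r - gibbs β x) * hy
  · simp only [rate, Fin.mk_one, Matrix.cons_val_zero, Matrix.cons_val_one, hk]
    linear_combination (Real.exp (β * x) + Real.exp (-(β * x))) * (r - gibbs β x) * hy

/-- The periodic solutions homologous to `f₁` are the chains `r f₁ + (1 - r) f₂` with `r` a
periodic solution of the scalar relaxation equation towards the equilibrium `gibbs β (E t)`. -/
theorem isPeriodicSolution_iff (m : ℕ) (β τ : ℝ) (E W : ℝ → ℝ) (ρ : ℝ → Fin 2 → ℝ) :
    (exampleIncidence m).IsPeriodicSolution β τ (fun t => ![E t, -E t]) (fun t => ![W t, -W t])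
        ![1, 0] ρ ↔
      ∃ r : ℝ → ℝ, ρ = (fun t => ![r t, 1 - r t]) ∧ Function.Periodic r 1 ∧
        ∀ t, HasDerivAt r (-(τ * rate β (E t) (W t) * (r t - gibbs β (E t)))) t := by
  have hH : ∀ t r : ℝ, -(τ • (exampleIncidence m).dynamicalOperator β ![E t, -E t] ![W t, -W t]
      ![r, 1 - r]) = ![-(τ * rate β (E t) (W t) * (r - gibbs β (E t))),
        τ * rate β (E t) (W t) * (r - gibbs β (E t))] := fun t r => by
    rw [CellComplex.Incidence.dynamicalOperator, LinearMap.comp_apply,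
      biasedCoboundary_apply_of_sum_eq_one, exampleIncidence_boundary]
    ext j
    fin_cases j <;> simp <;> ring
  constructor
  · intro h
    have hρ : ρ = fun t => ![ρ t 0, 1 - ρ t 0] := by
      ext t j
      have := (mem_range_boundary_iff m _).1 (h.homologous t)
      simp at this
      fin_cases j
      · rfl
      · simp; linarith
    refine ⟨fun t => ρ t 0, hρ, fun t => congrFun (h.periodic t) 0, fun t => ?_⟩
    have h1 := hasDerivAt_pi.1 (h.hasDerivAt t) 0
    rw [congrFun hρ t, hH] at h1
    exact h1
  · rintro ⟨r, rfl, hper, hr⟩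
    refine ⟨fun t => ?_, fun t => ?_, fun t => ?_⟩
    · rw [hH, hasDerivAt_pi]
      intro j
      fin_cases j
      · exact hr t
      · exact ((hr t).const_sub 1).congr_deriv (by simp)
    · simp only [hper t]
    · rw [mem_range_boundary_iff]
      simp

theorem continuous_of_periodic {f : ℝ → ℝ} (hf : Function.Periodic f 1)
    (hc : ContinuousOn f (Icc 0 1)) : Continuous f := by
  have h := AddCircle.liftIco_zero_continuous (p := (1 : ℝ)) (by simpa using (hf 0).symm) hc
  have h2 : f = AddCircle.liftIco 1 0 f ∘ ((↑) : ℝ → AddCircle (1 : ℝ)) := by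
    ext t
    have hp := Int.fract_lt_one t
    have h3 : ((Int.fract t : ℝ) : AddCircle (1 : ℝ)) = t := by
      have : Int.fract t = t - ⌊t⌋ • (1 : ℝ) := by simp
      rw [this, AddCircle.coe_sub, AddCircle.coe_zsmul, AddCircle.coe_period]
      simp
    rw [Function.comp, ← h3, AddCircle.liftIco_zero_coe_apply ⟨Int.fract_nonneg t, hp⟩]
    simpa using (hf.sub_zsmul_eq (x := t) ⌊t⌋).symm
  rw [h2]
  exact h.comp (AddCircle.continuous_mk' 1)

theorem exists_deriv_of_contDiffOn {f : ℝ → ℝ} (hf : ContDiffOn ℝ ∞ f (Icc 0 1)) :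
    ∃ f' : ℝ → ℝ, ContinuousOn f' (Icc 0 1) ∧ ∀ t ∈ Ioo (0 : ℝ) 1, HasDerivAt f (f' t) t := by
  refine ⟨derivWithin f (Icc 0 1),
    hf.continuousOn_derivWithin (uniqueDiffOn_Icc one_pos) (by simp), fun t ht => ?_⟩
  have hmem : Icc (0 : ℝ) 1 ∈ 𝓝 t := Icc_mem_nhds ht.1 ht.2
  exact (hf.differentiableOn (by simp) t (Ioo_subset_Icc_self ht)).hasDerivWithinAt.hasDerivAt hmem

/-! ### The average current and its adiabatic limit -/

section

variable {E W : ℝ → ℝ}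

theorem continuous_rate_comp (β : ℝ) (hE : Continuous E) (hW : Continuous W) :
    Continuous fun t => rate β (E t) (W t) := by
  unfold rate
  fun_prop

theorem existsUnique_isPeriodicSolution (m : ℕ) (β : ℝ) {τ : ℝ} (hτ : 0 < τ)
    (hE : Continuous E) (hW : Continuous W) (hEp : Function.Periodic E 1)
    (hWp : Function.Periodic W 1) :
    ∃! ρ, (exampleIncidence m).IsPeriodicSolution β τ (fun t => ![E t, -E t])
      (fun t => ![W t, -W t]) ![1, 0] ρ := by
  have hpos : ∀ t, 0 < τ * rate β (E t) (W t) := fun t =>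
    mul_pos hτ (one_pos.trans_le (one_le_rate _ _ _))
  obtain ⟨r, hr, hr'⟩ := exists_periodic_relaxation (a := fun t => τ * rate β (E t) (W t))
    (continuous_const.mul (continuous_rate_comp β hE hW)) ((continuous_gibbs β).comp hE)
    (fun t => by simp only [hEp t, hWp t]) (fun t => congrArg (gibbs β) (hEp t)) hpos
  refine ⟨_, (isPeriodicSolution_iff m β τ E W _).2 ⟨r, rfl, hr, hr'⟩, fun ρ hρ => ?_⟩
  obtain ⟨s, rfl, hs, hs'⟩ := (isPeriodicSolution_iff m β τ E W ρ).1 hρ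
  rw [periodic_relaxation_unique hs hr hpos hs' hr']

/-- For the scalar periodic solution `r`, the current is `j (w, 1 - w)` with total current
`j = -r'` and `w = gibbs β (W t)`; since `∫ j = 0`, the average current is antidiagonal. -/
theorem exists_averageCurrent_eq (m : ℕ) (β : ℝ) {τ : ℝ} (hτ : 0 < τ)
    (hE : Continuous E) (hW : Continuous W) (hEp : Function.Periodic E 1)
    (hWp : Function.Periodic W 1) :
    ∃ r : ℝ → ℝ, Function.Periodic r 1 ∧
      (∀ t, HasDerivAt r (-(τ * rate β (E t) (W t) * (r t - gibbs β (E t)))) t) ∧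
      (exampleIncidence m).averageCurrent β τ (fun t => ![E t, -E t]) (fun t => ![W t, -W t])
        ![1, 0] =
      let q := ∫ t in (0 : ℝ)..1,
        gibbs β (W t) * (τ * rate β (E t) (W t) * (r t - gibbs β (E t)))
      ![q, -q] := by
  have hex := (existsUnique_isPeriodicSolution m β hτ hE hW hEp hWp).exists
  have hspec : (exampleIncidence m).IsPeriodicSolution β τ (fun t => ![E t, -E t])
      (fun t => ![W t, -W t]) ![1, 0] ((exampleIncidence m).periodicSolution β τ
        (fun t => ![E t, -E t]) (fun t => ![W t, -W t]) ![1, 0]) := by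
    rw [CellComplex.Incidence.periodicSolution, dif_pos hex]
    exact hex.choose_spec
  obtain ⟨r, hρ, hper, hr⟩ := (isPeriodicSolution_iff m β τ E W _).1 hspec
  refine ⟨r, hper, hr, ?_⟩
  set j : ℝ → ℝ := fun t => τ * rate β (E t) (W t) * (r t - gibbs β (E t)) with hj
  have hrc : Continuous r := continuous_iff_continuousAt.2 fun t => (hr t).continuousAt
  have hjc : Continuous j :=
    (continuous_const.mul (continuous_rate_comp β hE hW)).mul
      (hrc.sub ((continuous_gibbs β).comp hE))
  have hgc : Continuous fun t => gibbs β (W t) := (continuous_gibbs β).comp hW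
  -- the total current `j = -r'` integrates to zero over a period
  have hj0 : ∫ t in (0 : ℝ)..1, j t = 0 := by
    have := intervalIntegral.integral_eq_sub_of_hasDerivAt (a := 0) (b := 1) (fun t _ => hr t)
      (hjc.neg.intervalIntegrable _ _)
    rw [intervalIntegral.integral_neg, ← zero_add (1 : ℝ), hper 0, sub_self] at this
    simpa using this
  have hJ : (exampleIncidence m).currentDensity β τ (fun t => ![E t, -E t])
      (fun t => ![W t, -W t]) ![1, 0] =
      fun t => ![gibbs β (W t) * j t, (1 - gibbs β (W t)) * j t] := by
    ext t i
    rw [CellComplex.Incidence.currentDensity, hρ, biasedCoboundary_apply_of_sum_eq_one]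
    fin_cases i <;> simp [hj] <;> ring
  rw [CellComplex.Incidence.averageCurrent, hJ]
  have hci : ∀ i : Fin 2, Continuous fun t =>
      (![gibbs β (W t) * j t, (1 - gibbs β (W t)) * j t] : Fin 2 → ℝ) i := fun i => by
    fin_cases i
    · exact hgc.mul hjc
    · exact (continuous_const.sub hgc).mul hjc
  have hi : IntervalIntegrable (fun t =>
      (![gibbs β (W t) * j t, (1 - gibbs β (W t)) * j t] : Fin 2 → ℝ))
      MeasureTheory.volume 0 1 :=
    (continuous_pi hci).intervalIntegrable _ _
  ext i
  refine ((ContinuousLinearMap.proj (R := ℝ) (φ := fun _ : Fin 2 => ℝ)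
    i).intervalIntegral_comp_comm hi).symm.trans ?_
  fin_cases i
  · rfl
  · change ∫ t in (0 : ℝ)..1, (1 - gibbs β (W t)) * j t =
      -∫ t in (0 : ℝ)..1, gibbs β (W t) * j t
    have hs := intervalIntegral.integral_sub
      (hjc.intervalIntegrable (μ := MeasureTheory.volume) 0 1)
      ((hgc.mul hjc).intervalIntegrable 0 1)
    rw [hj0, zero_sub] at hs
    exact (intervalIntegral.integral_congr fun t _ => one_sub_mul _ _).trans hs

theorem tendsto_averageCurrent (m : ℕ) (β : ℝ) {E' W' : ℝ → ℝ}
    (hE : Continuous E) (hW : Continuous W) (hEp : Function.Periodic E 1)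
    (hWp : Function.Periodic W 1) (hE' : ContinuousOn E' (Icc 0 1))
    (hW' : ContinuousOn W' (Icc 0 1)) (hEd : ∀ t ∈ Ioo (0 : ℝ) 1, HasDerivAt E (E' t) t)
    (hWd : ∀ t ∈ Ioo (0 : ℝ) 1, HasDerivAt W (W' t) t) :
    Tendsto (fun τ => (exampleIncidence m).averageCurrent β τ (fun t => ![E t, -E t])
      (fun t => ![W t, -W t]) ![1, 0]) atTop
      (𝓝 (let q := ∫ t in (0 : ℝ)..1,
        -(2 * β * W' t) * (gibbs β (W t) * (1 - gibbs β (W t))) * gibbs β (E t)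
      ![q, -q])) := by
  have hgE : Continuous fun t => gibbs β (E t) := (continuous_gibbs β).comp hE
  have hgW : Continuous fun t => gibbs β (W t) := (continuous_gibbs β).comp hW
  have hE01 : E 1 = E 0 := by simpa using hEp 0
  have hW01 : W 1 = W 0 := by simpa using hWp 0
  have hdE : ContinuousOn (fun t => -(2 * β * E' t) * (gibbs β (E t) * (1 - gibbs β (E t))))
      (Icc 0 1) := by fun_prop
  have hdW : ContinuousOn (fun t => -(2 * β * W' t) * (gibbs β (W t) * (1 - gibbs β (W t))))
      (Icc 0 1) := by fun_prop
  obtain ⟨C, hC⟩ := isCompact_Icc.exists_bound_of_continuousOn hdE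
  obtain ⟨D, hD⟩ := isCompact_Icc.exists_bound_of_continuousOn hdW
  have hlim : Tendsto (fun τ : ℝ => D * (1 + C) / 2 / √τ) atTop (𝓝 0) :=
    tendsto_const_nhds.div_atTop Real.tendsto_sqrt_atTop
  have hq : Tendsto (fun τ => (exampleIncidence m).averageCurrent β τ (fun t => ![E t, -E t])
      (fun t => ![W t, -W t]) ![1, 0] 0) atTop (𝓝 (∫ t in (0 : ℝ)..1,
        -(2 * β * W' t) * (gibbs β (W t) * (1 - gibbs β (W t))) * gibbs β (E t))) := by
    rw [tendsto_iff_norm_sub_tendsto_zero]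
    refine squeeze_zero' (Eventually.of_forall fun τ => norm_nonneg _) ?_ hlim
    filter_upwards [eventually_gt_atTop 0] with τ hτ
    obtain ⟨r, hper, hr, hQ⟩ := exists_averageCurrent_eq m β hτ hE hW hEp hWp
    have hpos : ∀ t, 0 < τ * rate β (E t) (W t) := fun t =>
      mul_pos hτ (one_pos.trans_le (one_le_rate _ _ _))
    rw [hQ]
    exact abs_integral_current_sub_le hτ hr (by simpa using hper 0)
      (ge_of_periodic_relaxation hper hpos hr fun t => gibbs_nonneg _ _)
      (le_of_periodic_relaxation hper hpos hr fun t => gibbs_le_one _ _)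
      (continuous_rate_comp β hE hW) (fun t => one_le_rate _ _ _) hgE.continuousOn
      (by simp only [hE01]) hdE (fun t ht => hasDerivAt_gibbs_comp β (hEd t ht)) hC
      hgW.continuousOn (by simp only [hW01]) hdW
      (fun t ht => hasDerivAt_gibbs_comp β (hWd t ht)) hD
  refine tendsto_pi_nhds.2 fun i => ?_
  fin_cases i
  · exact hq
  · refine hq.neg.congr' ?_
    filter_upwards [eventually_gt_atTop 0] with τ hτ
    obtain ⟨r, -, -, hQ⟩ := exists_averageCurrent_eq m β hτ hE hW hEp hWp
    rw [hQ]
    rfl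

end

end CycleFluctuation

open CycleFluctuation in
/-- Here `d = m + 2` runs over all integers `≥ 2`; the cells `f₁, f₂` and `e₁, e₂` are indexed by
`0, 1 : Fin 2`, so that `![1, -1]` is the chain `e₁ - e₂` and `![1, 0]` is the cycle `f₁`. -/
theorem theoremD (m : ℕ) :
    ∃ b : (exampleComplex m).Incidence,
      -- `e₁ - e₂` is a cycle and generates `H_d(X; ℤ) ≅ ℤ`
      (∃ (he : (![1, -1] : Fin 2 → ℤ) ∈ b.topHomology ℤ) (φ : b.topHomology ℤ ≃ₗ[ℤ] ℤ),
        φ ⟨![1, -1], he⟩ = 1) ∧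
      ∀ E₁ W₁ : ℝ → ℝ,
        Function.Periodic E₁ 1 → Function.Periodic W₁ 1 →
        ContDiffOn ℝ ∞ E₁ (Icc 0 1) → ContDiffOn ℝ ∞ W₁ (Icc 0 1) →
        W₁ 0 = 0 → W₁ (1 / 2) = 0 →
        (∀ t ∈ Ioo (0 : ℝ) (1 / 2), W₁ t < 0) → (∀ t ∈ Ioo (1 / 2 : ℝ) 1, 0 < W₁ t) →
        E₁ 0 = -1 → 0 < E₁ (1 / 2) →
        -- for slow driving there is a unique periodic solution, and the average current is a cycle
        (∀ β > 0, ∃ τ₀ > 0, ∀ τ > τ₀,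
          (∃! ρ, b.IsPeriodicSolution β τ
            (fun t => ![E₁ t, -E₁ t]) (fun t => ![W₁ t, -W₁ t]) ![1, 0] ρ) ∧
          b.averageCurrent β τ
            (fun t => ![E₁ t, -E₁ t]) (fun t => ![W₁ t, -W₁ t]) ![1, 0] ∈ b.topHomology ℝ) ∧
        -- the low temperature limit of the adiabatic limit is `e₁ - e₂`
        ∃ QB : ℝ → Fin 2 → ℝ,
          (∀ β > 0, Tendsto (fun τ => b.averageCurrent β τ
            (fun t => ![E₁ t, -E₁ t]) (fun t => ![W₁ t, -W₁ t]) ![1, 0]) atTop (𝓝 (QB β))) ∧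
          Tendsto QB atTop (𝓝 ![1, -1]) := by
  refine ⟨exampleIncidence m, ⟨(mem_topHomology_iff m _).2 (by simp), topHomologyEquiv m, rfl⟩, ?_⟩
  intro E W hEp hWp hEs hWs hW0 hW2 hWneg hWpos hE0 hE2
  have hE := continuous_of_periodic hEp hEs.continuousOn
  have hW := continuous_of_periodic hWp hWs.continuousOn
  obtain ⟨E', hE', hEd⟩ := exists_deriv_of_contDiffOn hEs
  obtain ⟨W', hW', hWd⟩ := exists_deriv_of_contDiffOn hWs
  have hE1 : E 1 = E 0 := by simpa using hEp 0
  have hW1 : W 1 = W 0 := by simpa using hWp 0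
  refine ⟨fun β _ => ⟨1, one_pos, fun τ hτ => ⟨?_, ?_⟩⟩, _,
    fun β _ => tendsto_averageCurrent m β hE hW hEp hWp hE' hW' hEd hWd, ?_⟩
  · exact existsUnique_isPeriodicSolution m β (one_pos.trans hτ) hE hW hEp hWp
  · obtain ⟨r, -, -, hQ⟩ := exists_averageCurrent_eq m β (one_pos.trans hτ) hE hW hEp hWp
    rw [hQ, mem_topHomology_iff]
    simp
  · have hq := tendsto_integral_gibbs hE.continuousOn hW.continuousOn hW' hWd hW1 hWneg hWpos
      (by linarith) (by linarith) hE2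
    refine tendsto_pi_nhds.2 fun i => ?_
    fin_cases i
    · exact hq
    · exact hq.neg
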